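/- Let $(X,m)$ be a probability space and let $(T_t)_{t\in\mathbb R}$ be a measurable flow on $X$ that preserves $m$: $T_0=\mathrm{id}$, $T_{s+t}=T_sT_t$, each $T_t$ is a measure-preserving map, and $(t,x)\mapsto T_tx$ is measurable with respect to the completion of the product of Lebesgue measure and $m$. Assume that the flow is ergodic (every measurable set $B$ with $m(T_t^{-1}B\,\Delta\,B)=0$ for all $t$ has measure $0$ or $1$) and aperiodic (there is no $p>0$ such that $m(T_p^{-1}B\,\Delta\,B)=0$ for every measurable set $B$). Write $T_tf=f\circ T_t$ for $f\in L_1(X,m)$. Let $\nu_n$ $(n\in\mathbb N)$ be Borel probability measures on $\mathbb R$, and let $P_n=\int_{\mathbb R}T_t\,d\nu_n(t)$ be the operator on $L_1(X,m)$ given by $P_nf=\int_{\mathbb R}T_tf\,d\nu_n(t)$ (Bochner integral in $L_1(X,m)$). Then for every real sequence $a_n\to 0^+$, every measurable set $A'\subset X$ with $m(A')>0$ and every $\varepsilon>0$ there exists a measurable set $A\subset X$ with $m(A'\Delta A)<\varepsilon$ such that $$\big\|P_n\mathbf 1_A-m(A)\big\|_{L_1(X,m)}>a_n\quad\text{for infinitely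 many } n .$$ -/

import Mathlib

open MeasureTheory Filter Set Topology
open scoped symmDiff

namespace MeasurableFlow

/-- The Koopman operator `T_t f = f ∘ T_t` on `L¹(X, m)` of the time-`t` map `T_t x = t +ᵥ x` of a
measure-preserving flow, i.e. of a measure-preserving action of the additive group `ℝ`. -/
noncomputable def koopman {X : Type*} [MeasurableSpace X] (m : Measure X)
    [AddAction ℝ X] [MeasurableConstVAdd ℝ X] [VAddInvariantMeasure ℝ X m] (t : ℝ) :
    Lp ℝ 1 m →ₗᵢ[ℝ] Lp ℝ 1 m :=
  Lp.compMeasurePreservingₗᵢ ℝ (fun x : X => t +ᵥ x) (measurePreserving_vadd t m)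

/-- The flow is a *measurable* flow: the map `(t, x) ↦ T_t x` is measurable on `ℝ × X`, where
`ℝ × X` carries the completion of the product of Lebesgue measure and `m`. -/
def IsMeasurableFlow {X : Type*} [MeasurableSpace X] (m : Measure X) [AddAction ℝ X] : Prop :=
  NullMeasurable (fun q : ℝ × X => q.1 +ᵥ q.2) ((volume : Measure ℝ).prod m)

/-- The flow is *aperiodic*: no `T_p` with `p > 0` is trivial modulo null sets, that is, fixes
every measurable set up to a set of measure zero. -/
def IsAperiodicFlow {X : Type*} [MeasurableSpace X] (m : Measure X) [AddAction ℝ X] : Prop :=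
  ∀ p : ℝ, 0 < p → ∃ B : Set X, MeasurableSet B ∧ m (((fun x : X => p +ᵥ x) ⁻¹' B) ∆ B) ≠ 0

section Group

variable {X : Type*} [MeasurableSpace X] {m : Measure X} [AddAction ℝ X]
  [MeasurableConstVAdd ℝ X] [VAddInvariantMeasure ℝ X m]

theorem koopman_add (s t : ℝ) (f : Lp ℝ 1 m) :
    koopman m (s + t) f = koopman m s (koopman m t f) := by
  have h := Lp.compMeasurePreserving_comp_apply f (measurePreserving_vadd t m)
    (measurePreserving_vadd s m)
  refine Eq.trans ?_ h
  have hfun : (fun x : X => (s + t) +ᵥ x) = (fun x => t +ᵥ x) ∘ fun x => s +ᵥ x := by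
    funext x; simp [add_comm s t, add_vadd]
  change Lp.compMeasurePreserving (fun x : X => (s + t) +ᵥ x) _ f = _
  congr! 2

theorem koopman_zero (f : Lp ℝ 1 m) : koopman m 0 f = f :=
  (koopman m 0).injective (by rw [← koopman_add, add_zero])

end Group

section Continuity

variable {X : Type*} [MeasurableSpace X] {m : Measure X} [IsProbabilityMeasure m]

theorem stronglyMeasurable_section {S : Set (ℝ × X)} (hS : MeasurableSet S) (c : ℝ) :
    StronglyMeasurable (fun t : ℝ =>
      indicatorConstLp (μ := m) 1 (measurable_prodMk_left (x := t) hS) (measure_ne_top m _)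
        c) := by
  induction S, hS using MeasurableSpace.induction_on_inter generateFrom_prod.symm isPiSystem_prod with
  | empty =>
    convert stronglyMeasurable_const (α := ℝ) (b := (0 : Lp ℝ 1 m)) using 2
    exact indicatorConstLp_empty
  | basic S hS =>
    obtain ⟨A, hA, B, hB, rfl⟩ := hS
    have hA : MeasurableSet A := hA
    have hB : MeasurableSet B := hB
    convert (stronglyMeasurable_const (α := ℝ)
      (b := indicatorConstLp (μ := m) 1 hB (measure_ne_top m _) c)).indicator hA using 1
    funext t
    by_cases ht : t ∈ A
    · rw [Set.indicator_of_mem ht]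
      congr 1
      ext x; simp [ht]
    · rw [Set.indicator_of_notMem ht, ← indicatorConstLp_empty (μ := m) (p := 1) (c := c)]
      congr 1
      ext x; simp [ht]
  | compl S hS ih =>
    convert (stronglyMeasurable_const (α := ℝ)
      (b := indicatorConstLp (μ := m) 1 MeasurableSet.univ (measure_ne_top m _) c)).sub ih
      using 1
    funext t
    rw [Pi.sub_apply, eq_sub_iff_add_eq, ← indicatorConstLp_disjoint_union]
    · congr 1
      ext x; simp
    · rw [Set.disjoint_left]; intro x hx hx'; exact hx hx'
  | iUnion f hd hf ih =>
    have hU : ∀ n, MeasurableSet (⋃ i < n, f i) := fun n =>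
      MeasurableSet.iUnion fun i => MeasurableSet.iUnion fun _ => hf i
    have h1 : ∀ n, StronglyMeasurable (fun t : ℝ =>
        indicatorConstLp (μ := m) 1 (measurable_prodMk_left (x := t) (hU n)) (measure_ne_top m _)
        c) := by
      intro n
      induction n with
      | zero =>
        convert stronglyMeasurable_const (α := ℝ) (b := (0 : Lp ℝ 1 m)) using 2
        rw [← indicatorConstLp_empty (μ := m) (p := 1) (c := c)]
        congr 1
        simp
      | succ n ihn =>
        convert ihn.add (ih n) using 1
        funext t
        rw [Pi.add_apply, ← indicatorConstLp_disjoint_union]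
        · congr 1
          rw [Set.biUnion_lt_succ]
          rfl
        · refine Disjoint.preimage _ ?_
          simp only [Set.disjoint_iUnion_left]
          intro i hi
          exact hd hi.ne
    refine stronglyMeasurable_of_tendsto atTop h1 ?_
    rw [tendsto_pi_nhds]
    intro t
    refine tendsto_indicatorConstLp_set ENNReal.one_ne_top ?_
    have hanti : Antitone fun n => (Prod.mk t ⁻¹' (⋃ i < n, f i)) ∆ (Prod.mk t ⁻¹' (⋃ i, f i)) := by
      intro a b hab x
      simp only [Set.mem_symmDiff, Set.mem_preimage, Set.mem_iUnion]
      rintro (⟨⟨i, hi, h⟩, h'⟩ | ⟨h, h'⟩)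
      · exact absurd ⟨i, h⟩ h'
      · exact Or.inr ⟨h, fun ⟨i, hi, hx⟩ => h' ⟨i, hi.trans_le hab, hx⟩⟩
    have := tendsto_measure_iInter_atTop (μ := m) (fun n =>
      ((measurable_prodMk_left (x := t) (hU n)).symmDiff
        (measurable_prodMk_left (x := t) (MeasurableSet.iUnion hf))).nullMeasurableSet) hanti
      ⟨0, measure_ne_top m _⟩
    have hempty : ⋂ n, (Prod.mk t ⁻¹' (⋃ i < n, f i)) ∆ (Prod.mk t ⁻¹' (⋃ i, f i)) = ∅ := ?_
    · rwa [hempty, measure_empty] at this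
    rw [Set.eq_empty_iff_forall_notMem]
    intro x hx
    simp only [Set.mem_iInter, Set.mem_symmDiff, Set.mem_preimage, Set.mem_iUnion] at hx
    rcases hx 0 with ⟨⟨i, hi, h⟩, h'⟩ | ⟨⟨i, h⟩, h'⟩
    · exact absurd ⟨i, h⟩ h'
    · rcases hx (i + 1) with ⟨_, h''⟩ | ⟨_, h''⟩
      · exact h'' ⟨i, h⟩
      · exact h'' ⟨i, Nat.lt_succ_self i, h⟩

variable [AddAction ℝ X] [MeasurableConstVAdd ℝ X] [VAddInvariantMeasure ℝ X m]

theorem aestronglyMeasurable_koopman_indicator (hT : IsMeasurableFlow (X := X) m) {B : Set X}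
    (hB : MeasurableSet B) (c : ℝ) :
    AEStronglyMeasurable
      (fun t : ℝ => koopman m t (indicatorConstLp 1 hB (measure_ne_top m B) c)) volume := by
  obtain ⟨S, hS, hSeq⟩ := hT hB
  refine ⟨fun t => indicatorConstLp (μ := m) 1 (measurable_prodMk_left (x := t) hS)
    (measure_ne_top m _) c, stronglyMeasurable_section hS c, ?_⟩
  filter_upwards [Measure.ae_ae_of_ae_prod hSeq] with t ht
  change Lp.compMeasurePreserving (fun x : X => t +ᵥ x) (measurePreserving_vadd t m)
    (indicatorConstLp 1 hB (measure_ne_top m B) c) = _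
  rw [Lp.indicatorConstLp_compMeasurePreserving]
  refine MemLp.toLp_congr _ _ (indicator_ae_eq_of_ae_eq_set ?_)
  filter_upwards [ht] with x hx
  exact hx

/-- A measurable flow acts on `L¹` strongly continuously. -/
theorem continuous_koopman (hT : IsMeasurableFlow (X := X) m) (f : Lp ℝ 1 m) :
    Continuous fun t : ℝ => koopman m t f := by
  induction f using Lp.induction ENNReal.one_ne_top with
  | indicatorConst c hB hμ =>
    rw [Lp.simpleFunc.coe_indicatorConst]
    have hae := aestronglyMeasurable_koopman_indicator hT hB c
    set f := indicatorConstLp 1 hB (measure_ne_top m _) c with hf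
    have hnorm : ∀ s t : ℝ, dist (koopman m s f) (koopman m t f) =
        dist (koopman m (s - t) f) f := by
      intro s t
      rw [← (koopman m t).isometry.dist_eq (koopman m (s - t) f), ← koopman_add]
      congr 3; ring
    have hzero : Tendsto (fun h : ℝ => dist (koopman m h f) f) (𝓝 0) (𝓝 0) := by
      rw [Metric.tendsto_nhds]
      intro ε hε
      obtain ⟨Y, hYsep, hY⟩ := hae.isSeparable_ae_range
      obtain ⟨D, hD, hYD⟩ := hYsep
      have : ∃ y ∈ D, volume ((fun t : ℝ => koopman m t f) ⁻¹' Metric.ball y (ε / 2)) ≠ 0 := by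
        by_contra! hcon
        have h0 : volume (⋃ y ∈ D,
            (fun t : ℝ => koopman m t f) ⁻¹' Metric.ball y (ε / 2)) = 0 :=
          (measure_biUnion_null_iff hD).2 hcon
        have h1 : ∀ᵐ t : ℝ, False := by
          filter_upwards [hY, measure_eq_zero_iff_ae_notMem.1 h0] with t ht ht'
          obtain ⟨y, hy, hdist⟩ := Metric.mem_closure_iff.1 (hYD ht) (ε / 2) (by positivity)
          exact ht' (Set.mem_biUnion hy hdist)
        exact NeZero.ne (volume : Measure ℝ) (by simpa using h1)
      obtain ⟨y, -, hy⟩ := this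
      have hnull : NullMeasurableSet ((fun t : ℝ => koopman m t f) ⁻¹' Metric.ball y (ε / 2))
          volume := by
        borelize ↥(Lp ℝ 1 m)
        exact hae.aemeasurable.nullMeasurable Metric.isOpen_ball.measurableSet
      obtain ⟨E, hEsub, hE, hEeq⟩ := hnull.exists_measurable_subset_ae_eq
      have hpos : 0 < volume E := by
        rw [measure_congr hEeq]; exact pos_iff_ne_zero.2 hy
      filter_upwards [Measure.sub_mem_nhds_zero_of_addHaar_pos volume E hE hpos] with h hh
      obtain ⟨s, hs, t, ht, rfl⟩ := hh
      rw [Real.dist_0_eq_abs, abs_of_nonneg dist_nonneg, ← hnorm]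
      have h1 : dist (koopman m s f) y < ε / 2 := hEsub hs
      have h2 : dist (koopman m t f) y < ε / 2 := hEsub ht
      linarith [dist_triangle_right (koopman m s f) (koopman m t f) y]
    rw [continuous_iff_continuousAt]
    intro t
    rw [ContinuousAt, tendsto_iff_dist_tendsto_zero]
    simp_rw [hnorm _ t]
    refine hzero.comp ?_
    have : Tendsto (fun s : ℝ => s - t) (𝓝 t) (𝓝 (t - t)) := (continuous_sub_right t).tendsto t
    simpa using this
  | add hf hg _ ihf ihg =>
    simp_rw [map_add]
    exact ihf.add ihg
  | isClosed =>
    rw [← isSeqClosed_iff_isClosed]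
    intro u f hu huf
    refine TendstoUniformly.continuous (F := fun n t => koopman m t (u n)) (p := atTop) ?_
      (Eventually.of_forall hu).frequently
    rw [Metric.tendstoUniformly_iff]
    intro ε hε
    filter_upwards [Metric.tendsto_nhds.1 huf ε hε] with n hn t
    rwa [(koopman m t).isometry.dist_eq, dist_comm]

theorem integrable_koopman (hT : IsMeasurableFlow (X := X) m) (ν : Measure ℝ) [IsFiniteMeasure ν]
    (f : Lp ℝ 1 m) : Integrable (fun t : ℝ => koopman m t f) ν :=
  Integrable.of_bound (continuous_koopman hT f).aestronglyMeasurable ‖f‖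
    (Eventually.of_forall fun t => ((koopman m t).norm_map f).le)

end Continuity

/-- The weighted average `P = ∫ T_t dν(t)` of a measurable flow, as a bounded operator on
`L¹(X, m)`: `P f` is the Bochner integral in `L¹(X, m)` of `t ↦ T_t f` against `ν`. -/
noncomputable def weightedAverage {X : Type*} [MeasurableSpace X] {m : Measure X}
    [IsProbabilityMeasure m] [AddAction ℝ X] [MeasurableConstVAdd ℝ X]
    [VAddInvariantMeasure ℝ X m] (hT : IsMeasurableFlow (X := X) m)
    (ν : Measure ℝ) [IsProbabilityMeasure ν] : Lp ℝ 1 m →L[ℝ] Lp ℝ 1 m :=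
  LinearMap.mkContinuous
    { toFun := fun f => ∫ t, koopman m t f ∂ν
      map_add' := fun f g => by
        simp_rw [map_add]
        exact integral_add (integrable_koopman hT ν f) (integrable_koopman hT ν g)
      map_smul' := fun c f => by
        simp_rw [map_smul]
        exact integral_smul c _ }
    1 (fun f => by
      refine (norm_integral_le_of_norm_le_const
        (Eventually.of_forall fun t => ((koopman m t).norm_map f).le)).trans ?_
      simp)

end MeasurableFlow

/-
By Baire's theorem in the complete metric space of measurable sets, with `d(A, B) = m(A ∆ B)`, it
suffices to find sets `B` of arbitrarily small measure on which the deviation of the average from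
the mean is bounded below independently of the averaging measure. If `T_t B` is close to `B` for
all `t` carrying most of the mass of `ν`, then `P 1_B` is close to `1_B`, which is far from the
constant `m(B)`.

Such a `B` is the set swept out during a time `u` by a set `E` of positive measure without returns
at times in a long interval `[1, R]`. This sweep is still small at a large time `u₀`, has measure
tending to `1` by ergodicity, and grows between `u` and `u + L` by at most about `L / u`, so at
some time `u ≥ u₀` it has a prescribed measure and is almost invariant under `T_t`, `|t| < L`.

If `T_p` is not trivial on `B`, then the time spent in `B` during a suitable `[0, θ]` is a function
that changes under `T_p` and is Lipschitz along orbits. A set where it drops by a definite amount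
under `T_p` has no returns at times near `p`. Compactness of `[1, R]` and ergodicity combine
finitely many such sets into `E`.
-/

namespace MeasurableFlow

local notation "𝟙[" m "]" hB:max => indicatorConstLp 1 hB (measure_ne_top m _) (1 : ℝ)

section MeasureAlgebra

variable {X : Type*} [MeasurableSpace X] {m : Measure X} [IsFiniteMeasure m]

theorem dist_indicatorConstLp_one {B C : Set X} (hB : MeasurableSet B) (hC : MeasurableSet C) :
    dist (𝟙[m] hB) (𝟙[m] hC) = m.real (B ∆ C) := by
  rw [dist_indicatorConstLp_eq_norm, norm_indicatorConstLp one_ne_zero ENNReal.one_ne_top]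
  simp

theorem exists_indicatorConstLp_eq {f : Lp ℝ 1 m} (hf : ∀ᵐ x ∂m, f x = 0 ∨ f x = 1) :
    ∃ (A : Set X) (hA : MeasurableSet A), 𝟙[m] hA = f := by
  have hA : MeasurableSet {x | f x = 1} :=
    (Lp.stronglyMeasurable f).measurable (measurableSet_singleton 1)
  refine ⟨_, hA, Lp.ext ?_⟩
  filter_upwards [hf, indicatorConstLp_coeFn (p := 1) (hs := hA) (hμs := measure_ne_top m _)
    (c := (1 : ℝ))] with x hx h1
  rw [h1]
  rcases hx with h | h <;> simp [indicator, h]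

theorem isClosed_setOf_indicatorConstLp :
    IsClosed {f : Lp ℝ 1 m | ∃ (A : Set X) (hA : MeasurableSet A), 𝟙[m] hA = f} := by
  refine IsSeqClosed.isClosed fun u f hu huf => exists_indicatorConstLp_eq ?_
  obtain ⟨φ, -, hφ⟩ := (tendstoInMeasure_of_tendsto_Lp huf).exists_seq_tendsto_ae
  have hvals : ∀ᵐ x ∂m, ∀ n, u n x ∈ ({0, 1} : Set ℝ) := by
    refine ae_all_iff.2 fun n => ?_
    obtain ⟨A, hA, hAu⟩ := hu n
    filter_upwards [indicatorConstLp_coeFn (p := 1) (hs := hA) (hμs := measure_ne_top m A)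
      (c := (1 : ℝ))] with x hx
    rw [← hAu, hx]
    by_cases h : x ∈ A <;> simp [h]
  filter_upwards [hφ, hvals] with x hx hx'
  exact (toFinite ({0, 1} : Set ℝ)).isClosed.mem_of_tendsto hx (.of_forall fun n => hx' (φ n))

variable {F : Type*} [NormedAddCommGroup F] [NormedSpace ℝ F]

-- `D 1_B` is the difference of the values of `D` at `A' ∪ B` and `A' \ B`, so one of them is large.
theorem exists_measureReal_symmDiff_le_norm_ge (D : Lp ℝ 1 m →L[ℝ] F) {A' B : Set X}
    (hA' : MeasurableSet A') (hB : MeasurableSet B) :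
    ∃ (A : Set X) (hA : MeasurableSet A),
      m.real (A' ∆ A) ≤ m.real B ∧ ‖D (𝟙[m] hB)‖ / 2 ≤ ‖D (𝟙[m] hA)‖ := by
  have hdiff := hA'.diff hB
  have hunion := hdiff.union hB
  have hsplit : D (𝟙[m] hunion) = D (𝟙[m] hdiff) + D (𝟙[m] hB) := by
    rw [← map_add, ← indicatorConstLp_disjoint_union _ _ _ _ disjoint_sdiff_left]
  have htri : ‖D (𝟙[m] hB)‖ ≤ ‖D (𝟙[m] hunion)‖ + ‖D (𝟙[m] hdiff)‖ := by
    rw [eq_sub_of_add_eq' hsplit.symm]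
    exact norm_sub_le _ _
  rcases le_or_gt (‖D (𝟙[m] hB)‖ / 2) ‖D (𝟙[m] hdiff)‖ with hlarge | hsmall
  · exact ⟨_, hdiff, measureReal_mono (by grind), hlarge⟩
  · exact ⟨_, hunion, measureReal_mono (by grind), by linarith⟩

theorem exists_infinite_lt_norm_indicator {D : ℕ → Lp ℝ 1 m →L[ℝ] F}
    (hD : ∀ η > 0, ∃ c > 0, ∀ n, ∃ (B : Set X) (hB : MeasurableSet B),
      c ≤ ‖D n (𝟙[m] hB)‖ ∧ m.real B < η)
    {a : ℕ → ℝ} (ha : Tendsto a atTop (𝓝 0)) {A' : Set X} (hA' : MeasurableSet A') {ε : ℝ}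
    (hε : 0 < ε) :
    ∃ (A : Set X) (hA : MeasurableSet A), m.real (A' ∆ A) < ε ∧
      {n | a n < ‖D n (𝟙[m] hA)‖}.Infinite := by
  let Y : Set (Lp ℝ 1 m) := {f | ∃ (A : Set X) (hA : MeasurableSet A), 𝟙[m] hA = f}
  have : CompleteSpace Y := isClosed_setOf_indicatorConstLp.completeSpace_coe
  let U : ℕ → Set Y := fun N => ⋃ n ≥ N, {y | a n < ‖D n y‖}
  have hUopen : ∀ N, IsOpen (U N) := fun N => isOpen_biUnion fun n _ =>
    isOpen_lt continuous_const ((D n).continuous.comp continuous_subtype_val).norm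
  have hUdense : ∀ N, Dense (U N) := by
    refine fun N => Metric.dense_iff.2 ?_
    rintro ⟨_, C, hC, rfl⟩ δ hδ
    obtain ⟨c, hc, hcD⟩ := hD δ hδ
    obtain ⟨n, hnc, hnN⟩ :=
      ((ha.eventually (gt_mem_nhds (half_pos hc))).and (eventually_ge_atTop N)).exists
    obtain ⟨B, hB, hBc, hBδ⟩ := hcD n
    obtain ⟨A, hA, hCA, hAB⟩ := exists_measureReal_symmDiff_le_norm_ge (D n) hC hB
    refine ⟨⟨_, A, hA, rfl⟩, ?_, mem_iUnion₂.2 ⟨n, hnN, hnc.trans_le (by linarith)⟩⟩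
    rw [Metric.mem_ball', Subtype.dist_eq, dist_indicatorConstLp_one]
    exact hCA.trans_lt hBδ
  obtain ⟨⟨_, A, hA, rfl⟩, hball, hmem⟩ := Metric.dense_iff.1
    (dense_iInter_of_isOpen hUopen hUdense) ⟨_, A', hA', rfl⟩ ε hε
  rw [Metric.mem_ball', Subtype.dist_eq, dist_indicatorConstLp_one] at hball
  refine ⟨A, hA, hball, infinite_of_forall_exists_gt fun N => ?_⟩
  obtain ⟨n, hn, hlt⟩ := mem_iUnion₂.1 (mem_iInter.1 hmem (N + 1))
  exact ⟨n, hlt, hn⟩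

theorem norm_indicator_sub_const_ge [IsProbabilityMeasure m] {B : Set X} (hB : MeasurableSet B) :
    m.real B * (1 - m.real B) ≤ ‖𝟙[m] hB - Lp.const 1 m (m.real B)‖ := by
  set f := 𝟙[m] hB - Lp.const 1 m (m.real B)
  have hf : f =ᵐ[m] fun x => B.indicator (fun _ => (1 : ℝ)) x - m.real B := by
    filter_upwards [Lp.coeFn_sub (𝟙[m] hB) (Lp.const 1 m (m.real B)),
      indicatorConstLp_coeFn (p := 1) (hs := hB) (hμs := measure_ne_top m _) (c := (1 : ℝ)),
      Lp.coeFn_const 1 m (m.real B)] with x hsub hind hconst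
    rw [hsub, Pi.sub_apply, hind, hconst, Function.const_apply]
  calc m.real B * (1 - m.real B) = ∫ x in B, f x ∂m := by
        rw [setIntegral_congr_ae hB (hf.mono fun x hx _ => hx),
          setIntegral_congr_fun hB (g := fun _ => 1 - m.real B) fun x hx => by simp [hx]]
        simp
    _ ≤ ∫ x in B, ‖f x‖ ∂m := (Real.le_norm_self _).trans (norm_integral_le_integral_norm _)
    _ ≤ ∫ x, ‖f x‖ ∂m :=
        setIntegral_le_integral (L1.integrable_coeFn f).norm (.of_forall fun _ => norm_nonneg _)
    _ = ‖f‖ := (L1.norm_eq_integral_norm f).symm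

end MeasureAlgebra

section Displacement

/-- The distance in the measure algebra between a set `B` and its preimage `T_t⁻¹ B`. -/
noncomputable def displacement {X : Type*} [MeasurableSpace X] (m : Measure X) [AddAction ℝ X]
    (B : Set X) (t : ℝ) : ℝ :=
  m.real (((t +ᵥ ·) ⁻¹' B) ∆ B)

variable {X : Type*} [MeasurableSpace X] {m : Measure X} [AddAction ℝ X]
  [MeasurableConstVAdd ℝ X] [VAddInvariantMeasure ℝ X m]

theorem measureReal_preimage_vadd {B : Set X} (hB : MeasurableSet B) (t : ℝ) :
    m.real ((t +ᵥ ·) ⁻¹' B) = m.real B :=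
  (measurePreserving_vadd t m).measureReal_preimage hB.nullMeasurableSet

theorem displacement_neg {B : Set X} (hB : MeasurableSet B) (t : ℝ) :
    displacement m B (-t) = displacement m B t := by
  have hpre : (t +ᵥ ·) ⁻¹' (((-t +ᵥ ·) ⁻¹' B) ∆ B) = ((t +ᵥ ·) ⁻¹' B) ∆ B := by
    simp [preimage_symmDiff, preimage_preimage, symmDiff_comm]
  rw [displacement, displacement, ← hpre,
    measureReal_preimage_vadd ((hB.preimage (measurable_const_vadd _)).symmDiff hB)]

theorem displacement_abs {B : Set X} (hB : MeasurableSet B) (t : ℝ) :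
    displacement m B |t| = displacement m B t := by
  rcases abs_choice t with h | h <;> rw [h]
  exact displacement_neg hB t

variable [IsFiniteMeasure m]

theorem displacement_eq_two_mul {B : Set X} (hB : MeasurableSet B) (t : ℝ) :
    displacement m B t = 2 * m.real (((t +ᵥ ·) ⁻¹' B) \ B) := by
  have hpre : MeasurableSet ((t +ᵥ ·) ⁻¹' B) := hB.preimage (measurable_const_vadd t)
  have hdiff : m.real (B \ ((t +ᵥ ·) ⁻¹' B)) = m.real (((t +ᵥ ·) ⁻¹' B) \ B) := by
    have h1 := measureReal_inter_add_sdiff (μ := m) (s := B) hpre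
    have h2 := measureReal_inter_add_sdiff (μ := m) (s := (t +ᵥ ·) ⁻¹' B) hB
    rw [inter_comm] at h2
    linarith [measureReal_preimage_vadd (m := m) hB t]
  rw [displacement, measureReal_symmDiff_eq hpre hB, hdiff]
  ring

theorem koopman_indicatorConstLp {B : Set X} (hB : MeasurableSet B) (c t : ℝ) :
    koopman m t (indicatorConstLp 1 hB (measure_ne_top m B) c) =
      indicatorConstLp 1 (hB.preimage (measurable_const_vadd t)) (measure_ne_top m _) c :=
  Lp.indicatorConstLp_compMeasurePreserving _ _ _ (measurePreserving_vadd t m)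

theorem norm_koopman_indicator_sub {B : Set X} (hB : MeasurableSet B) (t : ℝ) :
    ‖koopman m t (𝟙[m] hB) - 𝟙[m] hB‖ = displacement m B t := by
  rw [koopman_indicatorConstLp, ← dist_eq_norm, dist_indicatorConstLp_one, displacement]

end Displacement

section Continuity

variable {X : Type*} [MeasurableSpace X] {m : Measure X} [IsProbabilityMeasure m] [AddAction ℝ X]
  [MeasurableConstVAdd ℝ X] [VAddInvariantMeasure ℝ X m]

theorem continuous_displacement (hT : IsMeasurableFlow (X := X) m) {B : Set X}
    (hB : MeasurableSet B) : Continuous (displacement m B) := by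
  simp_rw [← funext (norm_koopman_indicator_sub hB)]
  exact ((continuous_koopman hT _).sub continuous_const).norm

theorem displacement_le_of_forall_rat (hT : IsMeasurableFlow (X := X) m) {B : Set X}
    (hB : MeasurableSet B) {r κ : ℝ} (h : ∀ q : ℚ, 0 ≤ q → q < r → displacement m B q ≤ κ)
    {t : ℝ} (ht : |t| < r) : displacement m B t ≤ κ := by
  by_contra! hlt
  obtain ⟨q, hq, hqr⟩ := Rat.denseRange_cast.exists_mem_open
    ((isOpen_lt continuous_const (continuous_displacement hT hB)).inter
      (isOpen_lt continuous_abs continuous_const)) ⟨t, hlt, ht⟩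
  have hle := h |q| (abs_nonneg q) (by rwa [Rat.cast_abs])
  rw [Rat.cast_abs, displacement_abs hB] at hle
  exact hle.not_gt hq

theorem continuous_measureReal_inter_preimage (hT : IsMeasurableFlow (X := X) m) {B C : Set X}
    (hB : MeasurableSet B) (hC : MeasurableSet C) :
    Continuous fun t : ℝ => m.real (C ∩ (t +ᵥ ·) ⁻¹' B) := by
  have hint : ∀ t, m.real (C ∩ (t +ᵥ ·) ⁻¹' B) = ∫ x in C, koopman m t (𝟙[m] hB) x ∂m := by
    intro t
    rw [koopman_indicatorConstLp, setIntegral_indicatorConstLp hC, smul_eq_mul, mul_one,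
      inter_comm]
  simp_rw [hint]
  exact (continuous_setIntegral C).comp (continuous_koopman hT _)

end Continuity

section Sweep

variable {X : Type*} [AddAction ℝ X]

/-- The points which visit `E` at a time in `Q`. Only rational times are admitted, so that this is
a countable union, measurable as soon as `E` is. -/
def sweep (Q : Set ℚ) (E : Set X) : Set X := {x | ∃ q ∈ Q, (q : ℝ) +ᵥ x ∈ E}

theorem sweep_mono {Q Q' : Set ℚ} (h : Q ⊆ Q') (E : Set X) : sweep Q E ⊆ sweep Q' E :=
  fun _ ⟨q, hq, hx⟩ => ⟨q, h hq, hx⟩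

theorem preimage_vadd_sweep (s : ℚ) (Q : Set ℚ) (E : Set X) :
    ((s : ℝ) +ᵥ ·) ⁻¹' sweep Q E = sweep ((· + s) '' Q) E := by
  ext x
  simp only [sweep, mem_preimage, mem_ofPred_eq, exists_mem_image, Rat.cast_add, add_vadd]

theorem sweep_sdiff_sweep_subset (E : Set X) {u τ : ℚ} (hu : 0 ≤ u) (hτ : 0 ≤ τ) (l : ℚ) :
    sweep (Icc 0 (u + τ + l)) E \ sweep (Icc 0 (u + τ)) E ⊆
      ((τ : ℝ) +ᵥ ·) ⁻¹' (sweep (Icc 0 (u + l)) E \ sweep (Icc 0 u) E) := by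
  rw [preimage_sdiff, preimage_vadd_sweep, preimage_vadd_sweep, image_add_const_Icc,
    image_add_const_Icc]
  rintro x ⟨⟨q, hq, hx⟩, hnot⟩
  refine ⟨⟨q, ?_, hx⟩, fun h => hnot (sweep_mono (Icc_subset_Icc_left (by linarith)) E h)⟩
  have hlate : u + τ < q := lt_of_not_ge fun h => hnot ⟨q, ⟨hq.1, h⟩, hx⟩
  constructor <;> linarith [hq.2]

theorem measurableSet_sweep [MeasurableSpace X] [MeasurableConstVAdd ℝ X] (Q : Set ℚ)
    {E : Set X} (hE : MeasurableSet E) : MeasurableSet (sweep Q E) := by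
  have hunion : sweep Q E = ⋃ q ∈ Q, ((q : ℝ) +ᵥ ·) ⁻¹' E := by
    ext; simp [sweep]
  rw [hunion]
  exact .biUnion Q.to_countable fun q _ => hE.preimage (measurable_const_vadd (q : ℝ))

end Sweep

section Ergodicity

variable {X : Type*} [MeasurableSpace X] {m : Measure X} [IsProbabilityMeasure m] [AddAction ℝ X]
  [MeasurableConstVAdd ℝ X]

theorem sweep_Ici_ae_eq_univ [ErgodicVAdd ℝ X m] (hT : IsMeasurableFlow (X := X) m)
    {E : Set X} (hE : MeasurableSet E) (hE0 : m E ≠ 0) : sweep (Ici 0) E =ᵐ[m] univ := by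
  have hU := measurableSet_sweep (Ici 0) hE
  have hpre : ∀ q : ℚ, 0 ≤ q → ((q : ℝ) +ᵥ ·) ⁻¹' sweep (Ici 0) E ⊆ sweep (Ici 0) E := by
    intro q hq
    rw [preimage_vadd_sweep, image_add_const_Ici, zero_add]
    exact sweep_mono (Ici_subset_Ici.2 hq) E
  have hinv : ∀ t, displacement m (sweep (Ici 0) E) t = 0 := by
    refine fun t => le_antisymm ?_ measureReal_nonneg
    refine displacement_le_of_forall_rat hT hU (fun q hq _ => ?_) (lt_add_one |t|)
    rw [displacement_eq_two_mul hU, sdiff_eq_empty.2 (hpre q hq), measureReal_empty, mul_zero]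
  have hconst := ErgodicVAdd.aeconst_of_forall_preimage_vadd_ae_eq (G := ℝ) (μ := m) hU fun t =>
    measure_symmDiff_eq_zero_iff.1 (measureReal_eq_zero_iff (by finiteness) |>.1 (hinv t))
  have hEU : E ⊆ sweep (Ici 0) E := fun x hx => ⟨0, self_mem_Ici, by simpa using hx⟩
  rcases eventuallyConst_set'.1 hconst with hnull | hfull
  · exact absurd (measure_mono_null hEU (ae_eq_empty.1 hnull)) hE0
  · exact hfull

end Ergodicity

section Occupation

variable {X : Type*} [AddAction ℝ X]

/-- The time that the orbit of `x` spends in `B` during `[0, θ]`. The lower integral keeps it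
Lipschitz along every orbit, also where the set of visiting times is not measurable. -/
noncomputable def occupation (B : Set X) (θ : ℝ) (x : X) : ℝ :=
  (∫⁻ t in Icc 0 θ, B.indicator 1 (t +ᵥ x)).toReal

theorem lintegral_Icc_indicator_vadd_le (B : Set X) (a b : ℝ) (x : X) :
    ∫⁻ t in Icc a b, B.indicator 1 (t +ᵥ x) ≤ ENNReal.ofReal (b - a) := by
  rw [← Real.volume_Icc, ← setLIntegral_one]
  exact lintegral_mono fun t => indicator_le_self' (by simp) _

theorem ofReal_occupation (B : Set X) (θ : ℝ) (x : X) :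
    ENNReal.ofReal (occupation B θ x) = ∫⁻ t in Icc 0 θ, B.indicator 1 (t +ᵥ x) :=
  ENNReal.ofReal_toReal
    ((lintegral_Icc_indicator_vadd_le B 0 θ x).trans_lt ENNReal.ofReal_lt_top).ne

theorem occupation_nonneg (B : Set X) (θ : ℝ) (x : X) : 0 ≤ occupation B θ x :=
  ENNReal.toReal_nonneg

theorem occupation_vadd_le (B : Set X) (θ s : ℝ) (x : X) :
    occupation B θ (s +ᵥ x) ≤ occupation B θ x + |s| := by
  set f : ℝ → ENNReal := fun t => B.indicator 1 (t +ᵥ x)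
  have hshift : ∫⁻ t in Icc 0 θ, B.indicator 1 (t +ᵥ s +ᵥ x) = ∫⁻ t in Icc s (s + θ), f t := by
    rw [← (measurePreserving_add_right volume s).setLIntegral_comp_preimage_emb
      (measurableEmbedding_addRight s) f, preimage_add_const_Icc, sub_self, add_sub_cancel_left]
    simp only [f, add_vadd]
  have hcover : Icc s (s + θ) ⊆ Icc 0 θ ∪ (Icc s 0 ∪ Icc θ (s + θ)) := by
    intro t ht
    grind
  refine (ENNReal.ofReal_le_ofReal_iff (add_nonneg (occupation_nonneg B θ x) (abs_nonneg s))).1 ?_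
  calc ENNReal.ofReal (occupation B θ (s +ᵥ x)) = ∫⁻ t in Icc s (s + θ), f t := by
        rw [ofReal_occupation, hshift]
    _ ≤ (∫⁻ t in Icc 0 θ, f t) + ((∫⁻ t in Icc s 0, f t) + ∫⁻ t in Icc θ (s + θ), f t) :=
        (lintegral_mono_set hcover).trans <| (lintegral_union_le _ _ _).trans <|
          add_le_add_right (lintegral_union_le _ _ _) _
    _ ≤ ENNReal.ofReal (occupation B θ x) +
          (ENNReal.ofReal (0 - s) + ENNReal.ofReal (s + θ - θ)) := by
        rw [ofReal_occupation]
        gcongr <;> exact lintegral_Icc_indicator_vadd_le _ _ _ _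
    _ = ENNReal.ofReal (occupation B θ x + |s|) := by
        rw [ENNReal.ofReal_add (occupation_nonneg B θ x) (abs_nonneg s), zero_sub,
          add_sub_cancel_right]
        congr 1
        rcases le_total 0 s with h | h
        · simp [ENNReal.ofReal_of_nonpos (neg_nonpos.2 h), abs_of_nonneg h]
        · simp [ENNReal.ofReal_of_nonpos h, abs_of_nonpos h]

variable [MeasurableSpace X] {m : Measure X} [IsProbabilityMeasure m]

theorem aemeasurable_indicator_flow (hT : IsMeasurableFlow (X := X) m) {B : Set X}
    (hB : MeasurableSet B) (I : Set ℝ) (C : Set X) :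
    AEMeasurable (fun q : ℝ × X => B.indicator (1 : X → ENNReal) (q.1 +ᵥ q.2))
      ((volume.restrict I).prod (m.restrict C)) := by
  rw [Measure.prod_restrict]
  exact (((measurable_one.indicator hB).comp_nullMeasurable hT).aemeasurable).restrict

theorem aemeasurable_occupation (hT : IsMeasurableFlow (X := X) m) {B : Set X}
    (hB : MeasurableSet B) (θ : ℝ) : AEMeasurable (occupation B θ) m := by
  have := (aemeasurable_indicator_flow hT hB (Icc 0 θ) univ).lintegral_prod_left'
  rw [Measure.restrict_univ] at this
  exact this.ennreal_toReal

theorem setLIntegral_occupation [MeasurableConstVAdd ℝ X] (hT : IsMeasurableFlow (X := X) m)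
    {B : Set X} (hB : MeasurableSet B) (C : Set X) (θ : ℝ) :
    ∫⁻ x in C, ENNReal.ofReal (occupation B θ x) ∂m =
      ∫⁻ t in Icc 0 θ, ENNReal.ofReal (m.real (C ∩ (t +ᵥ ·) ⁻¹' B)) := by
  simp_rw [ofReal_occupation]
  rw [← lintegral_lintegral_swap (aemeasurable_indicator_flow hT hB (Icc 0 θ) C)]
  refine lintegral_congr fun t => ?_
  have hpre : MeasurableSet ((t +ᵥ ·) ⁻¹' B) := hB.preimage (measurable_const_vadd t)
  rw [ofReal_measureReal, inter_comm, ← Measure.restrict_apply hpre, ← lintegral_indicator_one hpre]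
  rfl

variable [MeasurableConstVAdd ℝ X] [VAddInvariantMeasure ℝ X m]

theorem exists_measureReal_inter_preimage_lt (hT : IsMeasurableFlow (X := X) m) {B : Set X}
    (hB : MeasurableSet B) {p : ℝ} (hp : displacement m B p ≠ 0) :
    ∃ C : Set X, MeasurableSet C ∧ ∃ θ > (0 : ℝ), ∀ t ∈ Icc 0 θ,
      m.real (C ∩ (t +ᵥ ·) ⁻¹' B) < m.real (((p +ᵥ ·) ⁻¹' C) ∩ (t +ᵥ ·) ⁻¹' B) := by
  set C : Set X := ((-p +ᵥ ·) ⁻¹' B) \ B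
  have hC : MeasurableSet C := (hB.preimage (measurable_const_vadd (-p))).diff hB
  have hpre : MeasurableSet ((p +ᵥ ·) ⁻¹' C) := hC.preimage (measurable_const_vadd p)
  have hpreB : (p +ᵥ ·) ⁻¹' C ⊆ B := fun x hx => by simpa using hx.1
  have hpos : 0 < m.real C := by
    have hdisp : displacement m B p = 2 * m.real C := by
      rw [← displacement_neg hB, displacement_eq_two_mul hB]
    exact measureReal_nonneg.lt_of_ne' fun h => hp (by rw [hdisp, h, mul_zero])
  have hstart : m.real (C ∩ ((0 : ℝ) +ᵥ ·) ⁻¹' B) <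
      m.real (((p +ᵥ ·) ⁻¹' C) ∩ ((0 : ℝ) +ᵥ ·) ⁻¹' B) := by
    simpa only [zero_vadd, preimage_id', disjoint_sdiff_left.inter_eq, inter_eq_left.2 hpreB,
      measureReal_empty, measureReal_preimage_vadd hC, C] using hpos
  obtain ⟨δ, hδ, hball⟩ := Metric.eventually_nhds_iff_ball.1 <|
    (continuous_measureReal_inter_preimage hT hB hC).continuousAt.eventually_lt
      (continuous_measureReal_inter_preimage hT hB hpre).continuousAt hstart
  refine ⟨C, hC, δ / 2, half_pos hδ, fun t ht => hball t ?_⟩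
  rw [Metric.mem_ball, Real.dist_0_eq_abs, abs_of_nonneg ht.1]
  linarith [ht.2]

theorem exists_not_ae_occupation_le (hT : IsMeasurableFlow (X := X) m) {B : Set X}
    (hB : MeasurableSet B) {p : ℝ} (hp : displacement m B p ≠ 0) :
    ∃ θ, ¬ ∀ᵐ x ∂m, occupation B θ x ≤ occupation B θ (p +ᵥ x) := by
  obtain ⟨C, hC, θ, hθ, hlt⟩ := exists_measureReal_inter_preimage_lt hT hB hp
  refine ⟨θ, fun hle => ?_⟩
  have hswap : ∫⁻ x in (p +ᵥ ·) ⁻¹' C, ENNReal.ofReal (occupation B θ (p +ᵥ x)) ∂m =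
      ∫⁻ x in C, ENNReal.ofReal (occupation B θ x) ∂m :=
    (measurePreserving_vadd p m).setLIntegral_comp_preimage_emb
      (measurableEmbedding_const_vadd p) (fun x => ENNReal.ofReal (occupation B θ x)) C
  have hstrict : ∫⁻ t in Icc 0 θ, ENNReal.ofReal (m.real (C ∩ (t +ᵥ ·) ⁻¹' B)) <
      ∫⁻ t in Icc 0 θ, ENNReal.ofReal (m.real (((p +ᵥ ·) ⁻¹' C) ∩ (t +ᵥ ·) ⁻¹' B)) := by
    have hcont := continuous_measureReal_inter_preimage hT hB hC
    have hcont' := continuous_measureReal_inter_preimage hT hB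
      (hC.preimage (measurable_const_vadd p))
    exact setLIntegral_strict_mono measurableSet_Icc (by simpa using hθ)
      hcont'.measurable.ennreal_ofReal
      hcont.continuousOn.integrableOn_Icc.lintegral_lt_top.ne
      (.of_forall fun t ht =>
        (ENNReal.ofReal_lt_ofReal_iff_of_nonneg measureReal_nonneg).2 (hlt t ht))
  refine hstrict.not_ge ?_
  rw [← setLIntegral_occupation hT hB, ← setLIntegral_occupation hT hB, ← hswap]
  exact lintegral_mono_ae (ae_restrict_of_ae (hle.mono fun x => ENNReal.ofReal_le_ofReal))

end Occupation

section ReturnFree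

variable {X : Type*} [AddAction ℝ X]

/-- No orbit visits `E` twice with a time difference in `I`. -/
def IsReturnFree (E : Set X) (I : Set ℝ) : Prop := ∀ t ∈ I, ∀ x ∈ E, t +ᵥ x ∉ E

theorem IsReturnFree.mono {E : Set X} {I I' : Set ℝ} (h : IsReturnFree E I) (hI : I' ⊆ I) :
    IsReturnFree E I' :=
  fun t ht => h t (hI ht)

theorem IsReturnFree.inter_preimage_vadd {E E' : Set X} {I I' : Set ℝ} (h : IsReturnFree E I)
    (h' : IsReturnFree E' I') (s : ℝ) : IsReturnFree (E ∩ (s +ᵥ ·) ⁻¹' E') (I ∪ I') := by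
  rintro t (ht | ht) x hx htx
  · exact h t ht x hx.1 htx.1
  · exact h' t ht (s +ᵥ x) hx.2 (by rw [vadd_comm]; exact htx.2)

theorem IsReturnFree.disjoint_sweep {E : Set X} {I : Set ℝ} (h : IsReturnFree E I) {Q Q' : Set ℚ}
    (hQ : ∀ q ∈ Q, ∀ q' ∈ Q', ((q' - q : ℚ) : ℝ) ∈ I) : Disjoint (sweep Q E) (sweep Q' E) := by
  refine disjoint_left.2 ?_
  rintro x ⟨q, hq, hqx⟩ ⟨q', hq', hqx'⟩
  refine h _ (hQ q hq q' hq') _ hqx ?_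
  rwa [vadd_vadd, ← Rat.cast_add, sub_add_cancel]

variable [MeasurableSpace X] {m : Measure X} [MeasurableConstVAdd ℝ X]

theorem exists_isReturnFree_ball [VAddInvariantMeasure ℝ X m] {f : X → ℝ} (hf : AEMeasurable f m)
    (hlip : ∀ s x, f (s +ᵥ x) ≤ f x + |s|) {p : ℝ} (hp : ¬ ∀ᵐ x ∂m, f x ≤ f (p +ᵥ x)) :
    ∃ δ > 0, ∃ E, MeasurableSet E ∧ m E ≠ 0 ∧ IsReturnFree E (Metric.ball p δ) := by
  let S : ℚ × ℚ → Set X := fun c => {x | f (p +ᵥ x) < c.1} ∩ {x | (c.2 : ℝ) < f x}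
  obtain ⟨⟨a, b⟩, hab, hS⟩ : ∃ c : ℚ × ℚ, c.1 < c.2 ∧ m (S c) ≠ 0 := by
    by_contra! hnull
    refine hp ?_
    have hae : ∀ᵐ x ∂m, ∀ c : ℚ × ℚ, c.1 < c.2 → x ∉ S c :=
      ae_all_iff.2 fun c => eventually_imp_distrib_left.2 fun hc =>
        measure_eq_zero_iff_ae_notMem.1 (hnull c hc)
    filter_upwards [hae] with x hx
    by_contra! hlt
    obtain ⟨a, hpa, hax⟩ := exists_rat_btwn hlt
    obtain ⟨b, hab, hbx⟩ := exists_rat_btwn hax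
    exact hx (a, b) (Rat.cast_lt.1 hab) ⟨hpa, hbx⟩
  have hSm : NullMeasurableSet (S (a, b)) m :=
    (nullMeasurableSet_lt (hf.comp_quasiMeasurePreserving
      (measurePreserving_vadd p m).quasiMeasurePreserving) aemeasurable_const).inter
      (nullMeasurableSet_lt aemeasurable_const hf)
  obtain ⟨E, hES, hE, hEeq⟩ := hSm.exists_measurable_subset_ae_eq
  refine ⟨b - a, sub_pos.2 (Rat.cast_lt.2 hab), E, hE, by rwa [measure_congr hEeq],
    fun t ht x hx htx => ?_⟩
  have hvisit : f (t +ᵥ x) ≤ f (p +ᵥ x) + |t - p| := by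
    simpa [vadd_vadd] using hlip (t - p) (p +ᵥ x)
  have hnear : |t - p| < b - a := ht
  linarith [(hES hx).1.out, (hES htx).2.out]

variable [IsProbabilityMeasure m]

theorem exists_inter_preimage_vadd_ne_zero [ErgodicVAdd ℝ X m] (hT : IsMeasurableFlow (X := X) m)
    {E E' : Set X} (hE0 : m E ≠ 0) (hE' : MeasurableSet E') (hE0' : m E' ≠ 0) :
    ∃ s : ℝ, m (E ∩ (s +ᵥ ·) ⁻¹' E') ≠ 0 := by
  by_contra! hnull
  refine hE0 (measure_eq_zero_iff_ae_notMem.2 ?_)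
  filter_upwards [(sweep_Ici_ae_eq_univ hT hE' hE0').mem_iff,
    ae_all_iff.2 fun q : ℚ => measure_eq_zero_iff_ae_notMem.1 (hnull q)] with x hsweep hx hxE
  obtain ⟨q, -, hq⟩ := hsweep.2 (mem_univ x)
  exact hx q ⟨hxE, hq⟩

theorem exists_isReturnFree [ErgodicVAdd ℝ X m] (hT : IsMeasurableFlow (X := X) m)
    (hap : IsAperiodicFlow (X := X) m) {K : Set ℝ} (hK : IsCompact K) (hpos : K ⊆ Ioi 0) :
    ∃ E, MeasurableSet E ∧ m E ≠ 0 ∧ IsReturnFree E K := by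
  refine hK.induction_on (p := fun K => ∃ E, MeasurableSet E ∧ m E ≠ 0 ∧ IsReturnFree E K)
    ⟨univ, .univ, by simp, fun t ht => ht.elim⟩ ?_ ?_ ?_
  · rintro I I' hI ⟨E, hE, hE0, hfree⟩
    exact ⟨E, hE, hE0, hfree.mono hI⟩
  · rintro I I' ⟨E, hE, hE0, hfree⟩ ⟨E', hE', hE0', hfree'⟩
    obtain ⟨s, hs⟩ := exists_inter_preimage_vadd_ne_zero hT hE0 hE' hE0'
    exact ⟨_, hE.inter (hE'.preimage (measurable_const_vadd s)), hs,
      hfree.inter_preimage_vadd hfree' s⟩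
  · intro p hp
    obtain ⟨B, hB, hBp⟩ := hap p (hpos hp)
    obtain ⟨θ, hθ⟩ := exists_not_ae_occupation_le hT hB (p := p) <|
      mt (measureReal_eq_zero_iff (by finiteness)).1 hBp
    obtain ⟨δ, hδ, E, hE, hE0, hfree⟩ := exists_isReturnFree_ball
      (aemeasurable_occupation hT hB θ) (occupation_vadd_le B θ) hθ
    exact ⟨_, mem_nhdsWithin_of_mem_nhds (Metric.ball_mem_nhds p hδ), E, hE, hE0, hfree⟩

end ReturnFree

section Growth

variable {X : Type*} [MeasurableSpace X] {m : Measure X} [IsProbabilityMeasure m] [AddAction ℝ X]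
  [MeasurableConstVAdd ℝ X]

theorem measureReal_sweep_sdiff {E : Set X} (hE : MeasurableSet E) (u : ℚ) {v : ℚ} (huv : u ≤ v) :
    m.real (sweep (Icc 0 v) E \ sweep (Icc 0 u) E) =
      m.real (sweep (Icc 0 v) E) - m.real (sweep (Icc 0 u) E) :=
  measureReal_sdiff (sweep_mono (Icc_subset_Icc_right huv) E) (measurableSet_sweep _ hE)

theorem measureReal_sweep_sub_le [VAddInvariantMeasure ℝ X m] {E : Set X} (hE : MeasurableSet E)
    {u τ l : ℚ} (hu : 0 ≤ u) (hτ : 0 ≤ τ) (hl : 0 ≤ l) :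
    m.real (sweep (Icc 0 (u + τ + l)) E) - m.real (sweep (Icc 0 (u + τ)) E) ≤
      m.real (sweep (Icc 0 (u + l)) E) - m.real (sweep (Icc 0 u) E) := by
  rw [← measureReal_sweep_sdiff hE _ (le_add_of_nonneg_right hl),
    ← measureReal_sweep_sdiff hE _ (le_add_of_nonneg_right hl)]
  exact (measureReal_mono (sweep_sdiff_sweep_subset E hu hτ l)).trans_eq <|
    measureReal_preimage_vadd ((measurableSet_sweep _ hE).diff (measurableSet_sweep _ hE)) τ

-- Among the `k + 1` increments of the sweep up to time `(k + 1) L` the last one is the smallest.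
theorem measureReal_sweep_succ_mul_sub_le [VAddInvariantMeasure ℝ X m] {E : Set X}
    (hE : MeasurableSet E) {L : ℚ} (hL : 0 ≤ L) (k : ℕ) :
    m.real (sweep (Icc 0 ((k + 1 : ℕ) * L)) E) - m.real (sweep (Icc 0 (k * L)) E) ≤
      1 / (k + 1) := by
  set φ : ℕ → ℝ := fun i => m.real (sweep (Icc 0 (i * L)) E)
  have hlast : ∀ i ∈ Finset.range (k + 1), φ (k + 1) - φ k ≤ φ (i + 1) - φ i := by
    intro i hi
    have hik : (i : ℚ) ≤ k := by exact_mod_cast Finset.mem_range_succ_iff.1 hi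
    have h := measureReal_sweep_sub_le (m := m) hE (u := i * L) (τ := (k - i) * L) (by positivity)
      (mul_nonneg (sub_nonneg.2 hik) hL) hL
    rwa [← add_mul, add_sub_cancel, ← add_one_mul, ← add_one_mul, ← Nat.cast_succ,
      ← Nat.cast_succ] at h
  have hsum := Finset.card_nsmul_le_sum _ _ _ hlast
  rw [Finset.sum_range_sub, Finset.card_range, nsmul_eq_mul, Nat.cast_succ] at hsum
  have hφ0 : 0 ≤ φ 0 := measureReal_nonneg
  have hφ1 : φ (k + 1) ≤ 1 := measureReal_le_one
  rw [le_div_iff₀' (by positivity)]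
  linarith

theorem displacement_sweep_le [VAddInvariantMeasure ℝ X m] (hT : IsMeasurableFlow (X := X) m)
    {E : Set X} (hE : MeasurableSet E) (u L : ℚ) {t : ℝ} (ht : |t| < L) :
    displacement m (sweep (Icc 0 u) E) t ≤
      2 * (m.real (sweep (Icc 0 (u + L)) E) - m.real (sweep (Icc 0 u) E)) := by
  have hL : 0 ≤ L := by exact_mod_cast (abs_nonneg t).trans ht.le
  refine displacement_le_of_forall_rat hT (measurableSet_sweep _ hE) (fun s hs hsL => ?_) ht
  rw [displacement_eq_two_mul (measurableSet_sweep _ hE), preimage_vadd_sweep,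
    image_add_const_Icc, ← measureReal_sweep_sdiff hE u (le_add_of_nonneg_right hL)]
  have hsL' : s ≤ L := by exact_mod_cast hsL.le
  refine mul_le_mul_of_nonneg_left (measureReal_mono (sdiff_subset_sdiff_left ?_)) two_pos.le
  exact sweep_mono (Icc_subset_Icc (by linarith) (by linarith)) E

theorem tendsto_measureReal_sweep [ErgodicVAdd ℝ X m] (hT : IsMeasurableFlow (X := X) m)
    {E : Set X} (hE : MeasurableSet E) (hE0 : m E ≠ 0) {L : ℚ} (hL : 0 < L) :
    Tendsto (fun k : ℕ => m.real (sweep (Icc 0 (k * L)) E)) atTop (𝓝 1) := by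
  have hmono : Monotone fun k : ℕ => sweep (Icc 0 (k * L)) E := fun i j hij =>
    sweep_mono (Icc_subset_Icc_right (by gcongr)) E
  have hunion : ⋃ k : ℕ, sweep (Icc 0 (k * L)) E = sweep (Ici 0) E := by
    refine subset_antisymm (iUnion_subset fun k => sweep_mono Icc_subset_Ici_self E) ?_
    rintro x ⟨q, hq, hx⟩
    obtain ⟨k, hk⟩ := exists_nat_ge (q / L)
    exact mem_iUnion.2 ⟨k, q, ⟨hq, (div_le_iff₀ hL).1 hk⟩, hx⟩
  have hlim := tendsto_measure_iUnion_atTop (μ := m) hmono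
  rw [hunion, measure_congr (sweep_Ici_ae_eq_univ hT hE hE0), measure_univ] at hlim
  rw [← ENNReal.toReal_one]
  exact (ENNReal.tendsto_toReal ENNReal.one_ne_top).comp hlim

theorem mul_measureReal_sweep_le_one [VAddInvariantMeasure ℝ X m] {E : Set X}
    (hE : MeasurableSet E) {N : ℕ} {s : ℚ} (hs : 0 ≤ s)
    (hfree : IsReturnFree E (Icc 1 (N * (s + 1)))) : N * m.real (sweep (Icc 0 s) E) ≤ 1 := by
  let A : Fin N → Set X := fun i => (((i * (s + 1) : ℚ) : ℝ) +ᵥ ·) ⁻¹' sweep (Icc 0 s) E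
  have hdisj : Pairwise (Function.onFun Disjoint A) := by
    refine (pairwise_disjoint_on A).2 fun i j hij => ?_
    simp only [A, preimage_vadd_sweep, image_add_const_Icc]
    refine hfree.disjoint_sweep fun q hq q' hq' => ?_
    have hlower : ((i : ℕ) + 1 : ℚ) * (s + 1) ≤ (j : ℕ) * (s + 1) := by
      gcongr; exact_mod_cast hij
    have hupper : ((j : ℕ) + 1 : ℚ) * (s + 1) ≤ N * (s + 1) := by
      gcongr; exact_mod_cast j.is_lt
    have hi : 0 ≤ ((i : ℕ) : ℚ) * (s + 1) := by positivity
    have hgap : q' - q ∈ Icc 1 (N * (s + 1)) := by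
      constructor <;> linarith [hq.1, hq.2, hq'.1, hq'.2]
    exact ⟨by exact_mod_cast hgap.1, by exact_mod_cast hgap.2⟩
  calc N * m.real (sweep (Icc 0 s) E) = ∑ i, m.real (A i) := by
        simp [A, measureReal_preimage_vadd (measurableSet_sweep _ hE)]
    _ ≤ m.real univ := sum_measureReal_le_measureReal_univ
        (fun i _ => (measurableSet_sweep _ hE).preimage (measurable_const_vadd _))
        (hdisj.set_pairwise _)
    _ = 1 := probReal_univ

theorem exists_measureReal_sweep_le [ErgodicVAdd ℝ X m] (hT : IsMeasurableFlow (X := X) m)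
    (hap : IsAperiodicFlow (X := X) m) {s : ℚ} (hs : 0 ≤ s) {η : ℝ} (hη : 0 < η) :
    ∃ E, MeasurableSet E ∧ m E ≠ 0 ∧ m.real (sweep (Icc 0 s) E) ≤ η := by
  obtain ⟨N, hN⟩ := exists_nat_gt (1 / η)
  obtain ⟨E, hE, hE0, hfree⟩ := exists_isReturnFree hT hap
    (isCompact_Icc : IsCompact (Icc (1 : ℝ) (N * (s + 1)))) fun t ht => one_pos.trans_le ht.1
  have hNpos : (0 : ℝ) < N := (one_div_pos.2 hη).trans hN
  refine ⟨E, hE, hE0, (le_div_iff₀' hNpos).2 (mul_measureReal_sweep_le_one hE hs hfree) |>.trans ?_⟩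
  exact (one_div_lt hη hNpos).1 hN |>.le

theorem exists_almost_invariant [ErgodicVAdd ℝ X m] (hT : IsMeasurableFlow (X := X) m)
    (hap : IsAperiodicFlow (X := X) m) {η κ : ℝ} (hη : η ∈ Ioo 0 1) (hκ : 0 < κ) (r : ℝ) :
    ∃ B, MeasurableSet B ∧ m.real B ∈ Ioc η (η + κ) ∧ ∀ t, |t| ≤ r → displacement m B t ≤ κ := by
  obtain ⟨L, hL⟩ := exists_nat_gt (max r 0)
  obtain ⟨k₀, hk₀⟩ := exists_nat_gt (2 / κ)
  have hLpos : (0 : ℚ) < L := by exact_mod_cast (le_max_right r 0).trans_lt hL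
  obtain ⟨E, hE, hE0, hstart⟩ := exists_measureReal_sweep_le (m := m) hT hap
    (s := k₀ * L) (by positivity) hη.1
  set φ : ℕ → ℝ := fun k => m.real (sweep (Icc 0 (k * L)) E)
  have hincr : ∀ k ≥ k₀, φ (k + 1) - φ k ≤ κ / 2 := fun k hk => by
    refine (measureReal_sweep_succ_mul_sub_le hE hLpos.le k).trans ?_
    have hk₀k : 2 / κ < k + 1 := by
      have : (k₀ : ℝ) ≤ k := by exact_mod_cast hk
      linarith
    simpa using (one_div_lt_one_div_of_lt (by positivity) hk₀k).le
  obtain ⟨k, hk, hbelow, habove⟩ : ∃ k ≥ k₀, φ k ≤ η ∧ η < φ (k + 1) := by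
    by_contra! hstep
    have hbounded : ∀ k ≥ k₀, φ k ≤ η := fun k hk => Nat.le_induction hstart hstep k hk
    exact hη.2.not_ge <| le_of_tendsto (tendsto_measureReal_sweep hT hE hE0 hLpos) <|
      (eventually_ge_atTop k₀).mono hbounded
  refine ⟨_, measurableSet_sweep _ hE, ⟨habove, by linarith [hincr k hk]⟩, fun t ht => ?_⟩
  have htL : |t| < (L : ℚ) := by exact_mod_cast ht.trans_lt ((le_max_left r 0).trans_lt hL)
  have hmove := displacement_sweep_le hT hE ((k + 1 : ℕ) * L) L htL
  rw [← add_one_mul, ← Nat.cast_succ] at hmove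
  linarith [hincr (k + 1) (by omega)]

end Growth

section WeightedAverage

theorem exists_measureReal_lt_abs_lt (ν : Measure ℝ) [IsFiniteMeasure ν] {κ : ℝ} (hκ : 0 < κ) :
    ∃ r : ℝ, ν.real {t | r < |t|} < κ := by
  have htail := tendsto_measure_norm_gt_of_isTightMeasureSet (isTightMeasureSet_singleton (μ := ν))
  simp only [mem_singleton_iff, iSup_iSup_eq_left] at htail
  obtain ⟨r, hr⟩ := (htail.eventually (gt_mem_nhds (ENNReal.ofReal_pos.2 hκ))).exists
  exact ⟨r, (ENNReal.lt_ofReal_iff_toReal_lt (by finiteness)).1 hr⟩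

variable {X : Type*} [MeasurableSpace X] {m : Measure X} [IsProbabilityMeasure m]
  [AddAction ℝ X] [MeasurableConstVAdd ℝ X]

theorem norm_weightedAverage_indicator_sub_le [VAddInvariantMeasure ℝ X m]
    (hT : IsMeasurableFlow (X := X) m) (ν : Measure ℝ) [IsProbabilityMeasure ν] {B : Set X}
    (hB : MeasurableSet B) {κ r : ℝ} (hκ : 0 ≤ κ) (h : ∀ t, |t| ≤ r → displacement m B t ≤ κ) :
    ‖weightedAverage hT ν (𝟙[m] hB) - 𝟙[m] hB‖ ≤ κ + ν.real {t | r < |t|} := by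
  have haverage : weightedAverage hT ν (𝟙[m] hB) - 𝟙[m] hB =
      ∫ t, (koopman m t (𝟙[m] hB) - 𝟙[m] hB) ∂ν := by
    rw [integral_sub (integrable_koopman hT ν _) (integrable_const _)]
    simp [weightedAverage]
  have htail : MeasurableSet {t : ℝ | r < |t|} :=
    (isOpen_lt continuous_const continuous_abs).measurableSet
  have hint : Integrable ({t : ℝ | r < |t|}.indicator fun _ => (1 : ℝ)) ν :=
    (integrable_const 1).indicator htail
  rw [haverage]
  calc ‖∫ t, (koopman m t (𝟙[m] hB) - 𝟙[m] hB) ∂ν‖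
      ≤ ∫ t, (κ + {t : ℝ | r < |t|}.indicator (fun _ => (1 : ℝ)) t) ∂ν := by
        refine norm_integral_le_of_norm_le ((integrable_const κ).add hint) (.of_forall fun t => ?_)
        rw [norm_koopman_indicator_sub hB]
        by_cases ht : r < |t|
        · have hle : displacement m B t ≤ 1 := measureReal_le_one
          simpa [ht] using hle.trans (le_add_of_nonneg_left hκ)
        · simpa [ht] using h t (not_lt.1 ht)
    _ = κ + ν.real {t | r < |t|} := by
        rw [integral_add (integrable_const κ) hint, integral_indicator_const _ htail]
        simp

theorem exists_norm_weightedAverage_indicator_sub_le [ErgodicVAdd ℝ X m]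
    (hT : IsMeasurableFlow (X := X) m) (hap : IsAperiodicFlow (X := X) m) (ν : Measure ℝ)
    [IsProbabilityMeasure ν] {η κ : ℝ} (hη : η ∈ Ioo 0 1) (hκ : 0 < κ) :
    ∃ (B : Set X) (hB : MeasurableSet B), m.real B ∈ Ioc η (η + κ) ∧
      ‖weightedAverage hT ν (𝟙[m] hB) - 𝟙[m] hB‖ ≤ κ := by
  obtain ⟨r, hr⟩ := exists_measureReal_lt_abs_lt ν (half_pos hκ)
  obtain ⟨B, hB, hBη, hinv⟩ := exists_almost_invariant hT hap hη (half_pos hκ) r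
  refine ⟨B, hB, ⟨hBη.1, by linarith [hBη.2]⟩, ?_⟩
  linarith [norm_weightedAverage_indicator_sub_le hT ν hB (half_pos hκ).le hinv]

/-- The operator `f ↦ ∫ T_t f dν(t) - ∫ f dm` on `L¹`, the integral of `f` being regarded as a
constant function. Convergence of the averages to the mean is convergence of this operator to
`0`. -/
noncomputable def meanDeviation [VAddInvariantMeasure ℝ X m] (hT : IsMeasurableFlow (X := X) m)
    (ν : Measure ℝ) [IsProbabilityMeasure ν] : Lp ℝ 1 m →L[ℝ] Lp ℝ 1 m :=
  weightedAverage hT ν - (Lp.constL 1 m ℝ).comp L1.integralCLM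

theorem meanDeviation_indicator [VAddInvariantMeasure ℝ X m] (hT : IsMeasurableFlow (X := X) m)
    (ν : Measure ℝ) [IsProbabilityMeasure ν] {A : Set X} (hA : MeasurableSet A) :
    meanDeviation hT ν (𝟙[m] hA) = weightedAverage hT ν (𝟙[m] hA) - Lp.const 1 m (m.real A) := by
  have hmean : L1.integralCLM (𝟙[m] hA) = m.real A := by
    rw [← L1.integral_eq, L1.integral_eq_integral, integral_indicatorConstLp, smul_eq_mul, mul_one]
  simp [meanDeviation, hmean]

theorem exists_norm_meanDeviation_ge [ErgodicVAdd ℝ X m] (hT : IsMeasurableFlow (X := X) m)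
    (hap : IsAperiodicFlow (X := X) m) (ν : Measure ℝ) [IsProbabilityMeasure ν] {η : ℝ}
    (hη : η ∈ Ioc 0 (1 / 4)) :
    ∃ (B : Set X) (hB : MeasurableSet B), m.real B ≤ 2 * η ∧
      η / 4 ≤ ‖meanDeviation hT ν (𝟙[m] hB)‖ := by
  obtain ⟨hη0, hη1⟩ := hη
  obtain ⟨B, hB, ⟨hηB, hBη⟩, hclose⟩ := exists_norm_weightedAverage_indicator_sub_le hT hap ν
    (η := η) (κ := η / 4) ⟨hη0, by linarith⟩ (by positivity)
  have hfar : η / 2 ≤ ‖𝟙[m] hB - Lp.const 1 m (m.real B)‖ := by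
    refine le_trans ?_ (norm_indicator_sub_const_ge hB)
    nlinarith
  have htri := norm_sub_le_norm_sub_add_norm_sub (𝟙[m] hB) (weightedAverage hT ν (𝟙[m] hB))
    (Lp.const 1 m (m.real B))
  rw [norm_sub_rev (𝟙[m] hB) (weightedAverage hT ν _)] at htri
  refine ⟨B, hB, by linarith, ?_⟩
  rw [meanDeviation_indicator]
  linarith

theorem exists_pos_forall_norm_meanDeviation_ge [ErgodicVAdd ℝ X m]
    (hT : IsMeasurableFlow (X := X) m) (hap : IsAperiodicFlow (X := X) m) {η : ℝ} (hη : 0 < η) :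
    ∃ c > 0, ∀ (ν : Measure ℝ) [IsProbabilityMeasure ν], ∃ (B : Set X) (hB : MeasurableSet B),
      c ≤ ‖meanDeviation hT ν (𝟙[m] hB)‖ ∧ m.real B < η := by
  obtain ⟨ρ, hρ, hρmin⟩ := exists_between (show 0 < min (1 / 4) (η / 2) by positivity)
  obtain ⟨hρ_quarter, hρη⟩ := lt_min_iff.1 hρmin
  refine ⟨ρ / 4, by positivity, fun ν _ => ?_⟩
  obtain ⟨B, hB, hBρ, hBdev⟩ := exists_norm_meanDeviation_ge hT hap ν ⟨hρ, hρ_quarter.le⟩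
  exact ⟨B, hB, hBdev, by linarith⟩

end WeightedAverage

end MeasurableFlow

theorem theorem1 {X : Type*} [MeasurableSpace X] (m : Measure X) [IsProbabilityMeasure m]
    [AddAction ℝ X] [MeasurableConstVAdd ℝ X] [ErgodicVAdd ℝ X m]
    (hT : MeasurableFlow.IsMeasurableFlow (X := X) m)
    (hap : MeasurableFlow.IsAperiodicFlow (X := X) m)
    (ν : ℕ → Measure ℝ) [∀ n, IsProbabilityMeasure (ν n)]
    (a : ℕ → ℝ) (ha : Tendsto a atTop (𝓝[>] 0))
    (A' : Set X) (hA' : MeasurableSet A') (hA'pos : 0 < m A')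
    (ε : ℝ) (hε : 0 < ε) :
    ∃ (A : Set X) (hA : MeasurableSet A), m.real (A' ∆ A) < ε ∧
      {n : ℕ | a n < ‖MeasurableFlow.weightedAverage hT (ν n)
          (indicatorConstLp 1 hA (measure_ne_top m A) (1 : ℝ)) -
            Lp.const 1 m (m.real A)‖}.Infinite := by
  have hsmall : ∀ η > 0, ∃ c > 0, ∀ n, ∃ (B : Set X) (hB : MeasurableSet B),
      c ≤ ‖MeasurableFlow.meanDeviation hT (ν n)
        (indicatorConstLp 1 hB (measure_ne_top m B) (1 : ℝ))‖ ∧ m.real B < η := fun η hη => by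
    obtain ⟨c, hc, hdev⟩ := MeasurableFlow.exists_pos_forall_norm_meanDeviation_ge hT hap hη
    exact ⟨c, hc, fun n => hdev (ν n)⟩
  simpa only [MeasurableFlow.meanDeviation_indicator] using
    MeasurableFlow.exists_infinite_lt_norm_indicator hsmall (ha.mono_right nhdsWithin_le_nhds)
      hA' hε
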